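/- Let $A=(L,C,\to,\ell_0)$ be a closed discrete-time timed automaton: $L$ is a finite set of locations, $C$ a finite set of clocks, $\ell_0\in L$ the initial location, and $\to$ a finite set of transitions $(\ell,g,R,\ell')$ with $\ell,\ell'\in L$, $R\subseteq C$, and a guard $g$ assigning to every clock $x$ an interval $g(x)=[\mathrm{lb}(g(x)),\mathrm{ub}(g(x))]$ with $\mathrm{lb}\in\mathbb N$, $\mathrm{ub}\in\mathbb N\cup\{\infty\}$, $\mathrm{lb}\le\mathrm{ub}$ (the interval is $[\mathrm{lb},\infty)$ if $\mathrm{ub}=\infty$). Configurations are pairs $(\ell,v)$ with $\ell \in L$ and $v:C\to\mathbb N$. The discrete semantics $T_{DS}(A)$ has the transitions $(\ell,v)\to(\ell,v+d)$ for $d\in\mathbb N$ and $(\ell,v)\to(\ell',v[R:=0])$ whenever $(\ell,g,R,\ell')\in{\to}$ and $v(x)\in g(x)$ for all $x\in C$. A location $\ell_g$ is reachable in $T_{DS}(A)$ if some $(\ell_g,v)$ can be reached from $(\ell_0,0)$ by finitely many transitions. Let $M$ be the largest integer in any guard of $A$ ($0$ if there is none), and let $n\oplus m=M+1$ if $n+m>M$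 and $n\oplus m=n+m$ otherwise; $\oplus$ and $-$ are applied to valuations pointwise. An anchor point is a valuation $\alpha:C\to\mathbb N$ with $\alpha(x)=0$ for some $x\in C$ (if $C=\emptyset$, the unique valuation counts as one). The time-dart algorithm maintains a partial function $W$ from pairs (location, anchor point) to $\mathbb N\times(\mathbb N\cup\{\infty\})$, using the following procedure. $\mathrm{Add}(\ell,\alpha,w,p)$: if $\ell=\ell_g$, terminate the whole algorithm and return true. Otherwise, if $W(\ell,\alpha)$ is undefined, set it to $(w,p)$; if $W(\ell,\alpha)=(w',p')$, set it to $(\min(w,w'),\min(p,p'))$. The algorithm starts with $W$ nowhere defined and calls $\mathrm{Add}(\ell_0,0,0,\infty)$. Then, as long as there is $(\ell,\alpha)$ with $W(\ell,\alpha)=(w,p)$ and $w<p$, it chooses such a pair nondeterministically, sets $W(\ell,\alpha):=(w,w)$, and for each transition $(\ell,g,R,\ell')$ with source $\ell$ (in any order) does the following, with the values $\alpha,w,p$ found at the choice. Let $\mathit{start}=\max\{w,\max_{x\in C}(\mathrm{lb}(g(x))-\alpha(x))\}$ and $\mathit{end}=\min_{x\in C}(\mathrm{ub}(g(x))-\alpha(x))$.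 If $\mathit{start}<p$ and $\mathit{start}\le\mathit{end}$, then: - if $R=\emptyset$, call $\mathrm{Add}(\ell',(\alpha\oplus\mathit{start})-\mathit{start},\mathit{start},\infty)$; - if $R\ne\emptyset$, let $\mathit{stop}=\max\{\mathit{start},M+1-\min_{x\in C\setminus R}\alpha(x)\}$ and, for $n=\mathit{start},\dots,\min\{\mathit{end},p-1,\mathit{stop}\}$ in increasing order, call $\mathrm{Add}(\ell',(\alpha\oplus n)[R:=0],0,\infty)$. When no pair with $w<p$ is left, it returns false. (Here $\min\emptyset=\infty$ and $\max\emptyset=-\infty$.) **Theorem.** For every such $A$ and every $\ell_g\in L$, the algorithm terminates under all nondeterministic choices, i.e. no run is infinite and every run that cannot be continued has returned true or false. Moreover, in every run that returns a value, the value is true if and only if $\ell_g$ is reachable in $T_{DS}(A)$. -/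

import Mathlib

namespace TimedDarts

/-! ### Timed automata and their discrete semantics -/

/-- A closed time interval `[lb, ub]` with `lb ≤ ub`, where `ub = ⊤` stands for `[lb, ∞)`. -/
structure Interval where
  lb : ℕ
  ub : ℕ∞
  lb_le_ub : (lb : ℕ∞) ≤ ub

/-- Membership of a natural number in an interval. -/
def Interval.Contains (I : Interval) (n : ℕ) : Prop :=
  I.lb ≤ n ∧ (n : ℕ∞) ≤ I.ub

/-- A discrete clock valuation. -/
abbrev Valuation (C : Type*) := C → ℕ

/-- A clock guard assigns a time interval to each clock. -/
abbrev Guard (C : Type*) := C → Interval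

/-- The valuation `v + d` after a delay of `d`. -/
def Valuation.delay {C : Type*} (v : Valuation C) (d : ℕ) : Valuation C :=
  fun x => v x + d

open Classical in
/-- The valuation `v[R := 0]`. -/
noncomputable def Valuation.reset {C : Type*} (v : Valuation C) (R : Finset C) : Valuation C :=
  fun x => if x ∈ R then 0 else v x

/-- `v ⊨ g`. -/
def Guard.Sat {C : Type*} (v : Valuation C) (g : Guard C) : Prop :=
  ∀ x, (g x).Contains (v x)

/-- A transition `(ℓ, g, R, ℓ')`. -/
structure Edge (L C : Type*) where
  src : L
  guard : Guard C
  resets : Finset C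
  tgt : L

/-- A timed automaton with locations `L` and clocks `C` (finiteness of `L` and `C` is assumed
where automata are used). -/
structure TimedAutomaton (L C : Type*) where
  edges : Finset (Edge L C)
  init : L

/-- Actions of a discrete timed transition system. -/
inductive Action where
  | delay (d : ℕ)
  | switch

/-- A discrete timed transition system with state set `S`. -/
structure DTTS (S : Type*) where
  trans : S → Action → S → Prop

/-- The reflexive and transitive closure of the union of all transitions. -/
def DTTS.Reaches {S : Type*} (T : DTTS S) : S → S → Prop :=
  Relation.ReflTransGen (fun s s' => ∃ a, T.trans s a s')

/-- The transitions of the discrete semantics. -/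
inductive DiscreteTrans {L C : Type*} (A : TimedAutomaton L C) :
    L × Valuation C → Action → L × Valuation C → Prop
  | switch (e : Edge L C) (he : e ∈ A.edges) (v : Valuation C) (hv : Guard.Sat v e.guard) :
      DiscreteTrans A (e.src, v) Action.switch (e.tgt, v.reset e.resets)
  | delay (l : L) (v : Valuation C) (d : ℕ) :
      DiscreteTrans A (l, v) (Action.delay d) (l, v.delay d)

/-- The discrete semantics `T_DS(A)`. -/
def discreteSemantics {L C : Type*} (A : TimedAutomaton L C) : DTTS (L × Valuation C) :=
  ⟨DiscreteTrans A⟩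

/-- The location `lg` is reachable in `T_DS(A)`: from the initial location with all clocks zero,
some configuration with location `lg` is reached. -/
def LocReachable {L C : Type*} (A : TimedAutomaton L C) (lg : L) : Prop :=
  ∃ v : Valuation C, (discreteSemantics A).Reaches (A.init, fun _ => 0) (lg, v)

/-- The largest integer in any guard of `A` (`0` if there is none). -/
def maxConst {L C : Type*} [Fintype C] (A : TimedAutomaton L C) : ℕ :=
  A.edges.sup fun e => Finset.univ.sup fun x => max (e.guard x).lb (e.guard x).ub.toNat

/-- Addition bounded by `M`. -/
def boundedAdd (M n m : ℕ) : ℕ :=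
  if n + m > M then M + 1 else n + m

/-! ### Anchor points and the passed-waiting list -/

/-- Anchor points: valuations with at least one clock equal to `0`. If there are no clocks at all,
the unique valuation counts as an anchor point. -/
def IsAnchor {C : Type*} (a : Valuation C) : Prop :=
  IsEmpty C ∨ ∃ x, a x = 0

/-- The type of anchor points over `C`. -/
abbrev Anchor (C : Type*) := {a : Valuation C // IsAnchor a}

/-- The anchor point with all clocks `0`. -/
def Anchor.zero (C : Type*) : Anchor C :=
  ⟨fun _ => 0, (isEmpty_or_nonempty C).imp_right fun ⟨x⟩ => ⟨x, rfl⟩⟩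

/-- The anchor point `(a ⊕_M start) - start`. (For `start ≤ M + 1` the subtraction is exact.) -/
def Anchor.shift {C : Type*} (M : ℕ) (a : Anchor C) (start : ℕ) : Anchor C :=
  ⟨fun x => boundedAdd M (a.1 x) start - start, a.2.imp_right fun ⟨x, hx⟩ => ⟨x, by
    simp only [hx, boundedAdd]; split <;> omega⟩⟩

/-- The anchor point `(a ⊕_M n)[R := 0]`, for a nonempty set `R` of clocks. -/
noncomputable def Anchor.advanceReset {C : Type*} (M : ℕ) (a : Anchor C) (n : ℕ) (R : Finset C)
    (hR : R ≠ ∅) : Anchor C :=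
  ⟨Valuation.reset (fun x => boundedAdd M (a.1 x) n) R, by
    obtain ⟨x, hx⟩ := Finset.nonempty_iff_ne_empty.mpr hR
    exact Or.inr ⟨x, by simp [Valuation.reset, hx]⟩⟩

/-- A passed-waiting list; `none` is the undefined value. -/
abbrev PWList (L C : Type*) := L × Anchor C → Option (ℕ × ℕ∞)

/-! ### The time-dart reachability algorithm -/

open Classical in
/-- The procedure `AddToPW(l, a, w, p)`. The result `none` means that the whole algorithm
terminates and returns true; otherwise the updated passed-waiting list is produced. -/
noncomputable def addToPW {L C : Type*} (lg : L) (W : PWList L C) (l : L) (a : Anchor C)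
    (w : ℕ) (p : ℕ∞) : Option (PWList L C) :=
  if l = lg then none
  else
    match W (l, a) with
    | none => some (Function.update W (l, a) (some (w, p)))
    | some (w', p') => some (Function.update W (l, a) (some (min w w', min p p')))

/-- `start = max {w, max {lb (g x) - a x | x ∈ C}}`. Since `w ≥ 0`, negative differences may be
replaced by `0`, so natural number subtraction is harmless. -/
def startDelay {C : Type*} [Fintype C] (g : Guard C) (a : Anchor C) (w : ℕ) : ℕ :=
  max w (Finset.univ.sup fun x => (g x).lb - a.1 x)

/-- `end = min {ub (g x) - a x | x ∈ C}`, a possibly negative integer or `∞`. -/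
def endDelay {C : Type*} [Fintype C] (g : Guard C) (a : Anchor C) : WithTop ℤ :=
  Finset.univ.inf fun x => ENat.map (fun b : ℕ => (b : ℤ) - (a.1 x : ℤ)) (g x).ub

open Classical in
/-- `stop = max {start, M + 1 - min {a x | x ∈ C \ R}}`, where `min ∅ = ∞`, so that `stop = start`
when all clocks are reset. (A negative difference is replaced by `0`, which is at most `start`.) -/
noncomputable def stopDelay {C : Type*} [Fintype C] (M : ℕ) (a : Anchor C) (R : Finset C)
    (start : ℕ) : ℕ :=
  max start (((M + 1 : ℕ) : ℕ∞) - (Finset.univ \ R).inf fun x => (a.1 x : ℕ∞)).toNat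

open Classical in
/-- The increasing list of the values `n = start, …, min {end, p - 1, stop}` of the for-loop. -/
noncomputable def forValues (start : ℕ) (fin : WithTop ℤ) (p : ℕ∞) (bound : ℕ) : List ℕ :=
  (List.range (bound + 1)).filter fun n => start ≤ n ∧
    ((n : ℤ) : WithTop ℤ) ≤ min fin (min (ENat.map (fun b : ℕ => (b : ℤ)) (p - 1)) (bound : ℤ))

open Classical in
/-- The body of the foreach-loop for the edge `e`, where `(a, w, p)` is the selected dart and `W`
the current passed-waiting list. The result `none` means that the algorithm returns true. -/
noncomputable def processEdge {L C : Type*} [Fintype C] (A : TimedAutomaton L C) (lg : L)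
    (a : Anchor C) (w : ℕ) (p : ℕ∞) (e : Edge L C) (W : PWList L C) : Option (PWList L C) :=
  let M := maxConst A
  let start := startDelay e.guard a w
  let fin := endDelay e.guard a
  if (start : ℕ∞) < p ∧ ((start : ℤ) : WithTop ℤ) ≤ fin then
    if hR : e.resets = ∅ then
      addToPW lg W e.tgt (a.shift M start) start ⊤
    else
      (forValues start fin p (stopDelay M a e.resets start)).foldlM
        (fun W' n => addToPW lg W' e.tgt (a.advanceReset M n e.resets hR) 0 ⊤) W
  else some W

/-- Control states of the algorithm. -/
inductive AlgState (L C : Type*) where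
  /-- about to test the condition of the while-loop -/
  | whileLoop (W : PWList L C)
  /-- inside the foreach-loop for the selected dart `(a, w, p)`, with the edges `todo` still to be
  processed -/
  | forEach (W : PWList L C) (a : Anchor C) (w : ℕ) (p : ℕ∞) (todo : Finset (Edge L C))
  /-- the algorithm has terminated and returned `b` -/
  | returned (b : Bool)

/-- The state after the initialisation. -/
noncomputable def initState {L C : Type*} (A : TimedAutomaton L C) (lg : L) : AlgState L C :=
  match addToPW lg (fun _ => none) A.init (Anchor.zero C) 0 ⊤ with
  | none => AlgState.returned true
  | some W => AlgState.whileLoop W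

open Classical in
/-- The steps of the algorithm. Both the selection of the dart in the while-loop and the order in
which the foreach-loop processes the edges are nondeterministic. -/
inductive AlgStep {L C : Type*} [Fintype C] (A : TimedAutomaton L C) (lg : L) :
    AlgState L C → AlgState L C → Prop
  | select (W : PWList L C) (l : L) (a : Anchor C) (w : ℕ) (p : ℕ∞)
      (hW : W (l, a) = some (w, p)) (hwp : (w : ℕ∞) < p) :
      AlgStep A lg (.whileLoop W)
        (.forEach (Function.update W (l, a) (some (w, (w : ℕ∞)))) a w p
          (A.edges.filter fun e => e.src = l))
  | exit (W : PWList L C)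
      (hW : ¬ ∃ (l : L) (a : Anchor C) (w : ℕ) (p : ℕ∞), W (l, a) = some (w, p) ∧ (w : ℕ∞) < p) :
      AlgStep A lg (.whileLoop W) (.returned false)
  | edge (W W' : PWList L C) (a : Anchor C) (w : ℕ) (p : ℕ∞) (todo : Finset (Edge L C))
      (e : Edge L C) (he : e ∈ todo) (h : processEdge A lg a w p e W = some W') :
      AlgStep A lg (.forEach W a w p todo) (.forEach W' a w p (todo.erase e))
  | edgeReturn (W : PWList L C) (a : Anchor C) (w : ℕ) (p : ℕ∞) (todo : Finset (Edge L C))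
      (e : Edge L C) (he : e ∈ todo) (h : processEdge A lg a w p e W = none) :
      AlgStep A lg (.forEach W a w p todo) (.returned true)
  | endForEach (W : PWList L C) (a : Anchor C) (w : ℕ) (p : ℕ∞) :
      AlgStep A lg (.forEach W a w p ∅) (.whileLoop W)

/-- The state `s` occurs in some run of the algorithm. -/
def AlgReaches {L C : Type*} [Fintype C] (A : TimedAutomaton L C) (lg : L)
    (s : AlgState L C) : Prop :=
  Relation.ReflTransGen (AlgStep A lg) (initState A lg) s

/-- Every run terminates: there is no infinite run, and a run can only end by returning a
value. -/
def AlgTerminates {L C : Type*} [Fintype C] (A : TimedAutomaton L C) (lg : L) : Prop :=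
  (¬ ∃ r : ℕ → AlgState L C, r 0 = initState A lg ∧ ∀ i, AlgStep A lg (r i) (r (i + 1))) ∧
  ∀ s, AlgReaches A lg s → (∀ s', ¬ AlgStep A lg s s') → ∃ b, s = AlgState.returned b

end TimedDarts

namespace TimedDarts

/-! All finite guard constants are at most `M`, so valuations that agree up to identifying values
above `M` satisfy the same guards (`CapEq.sat`), and this relation survives delays and resets. An
entry `W(l, α) = (w, p)` represents the points `(l, α + d)` with `d ≥ w`; those with `d ≥ p` count
as passed.

Soundness: for each entry, `α + w` agrees up to the cap with a reachable configuration at `l`.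
Completeness: each switch enabled at a passed point leads to a represented point, unless it is still
pending in the foreach-loop. The core is `exists_processEdge_eq_foldlM`: processing an edge adds
finitely many sound darts which together represent all its switches from `α + n`, `w ≤ n < p`. On
normal exit `p ≤ w` holds everywhere, so every represented point is passed; the represented set
contains the initial configuration, is closed under steps, and avoids the goal location.

Termination: anchors stay at most `M + 1`, leaving finitely many keys, and waiting distances stay at
most `M`. Selecting a dart lowers its passed distance to `w ≤ M`, while adding darts never raises
one. Passed distances truncated at `M + 1` thus give a natural number that drops at every selection;
between selections, the number of remaining edges drops. -/

variable {L C : Type*}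

/-! ### Equality of valuations up to the cap `M + 1` -/

/-- Two valuations agree clockwise, up to identifying all values above `M`. -/
def CapEq (M : ℕ) (u v : Valuation C) : Prop :=
  ∀ x, u x = v x ∨ (M < u x ∧ M < v x)

theorem CapEq.refl (M : ℕ) (u : Valuation C) : CapEq M u u := fun _ => Or.inl rfl

theorem CapEq.symm {M : ℕ} {u v : Valuation C} (h : CapEq M u v) : CapEq M v u := fun x => by
  have := h x
  omega

theorem CapEq.trans {M : ℕ} {u v w : Valuation C} (h : CapEq M u v) (h' : CapEq M v w) :
    CapEq M u w := fun x => by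
  have := h x
  have := h' x
  omega

theorem CapEq.delay {M : ℕ} {u v : Valuation C} (h : CapEq M u v) (d : ℕ) :
    CapEq M (u.delay d) (v.delay d) := fun x => by
  have := h x
  simp only [Valuation.delay]
  omega

theorem CapEq.reset {M : ℕ} {u v : Valuation C} (h : CapEq M u v) (R : Finset C) :
    CapEq M (u.reset R) (v.reset R) := fun x => by
  simp only [Valuation.reset]
  split
  · exact Or.inl rfl
  · exact h x

theorem Valuation.delay_delay (v : Valuation C) (c d : ℕ) :
    (v.delay c).delay d = v.delay (c + d) := by
  funext x
  simp only [Valuation.delay]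
  omega

theorem Valuation.reset_empty (v : Valuation C) : v.reset ∅ = v := by
  funext x
  simp [Valuation.reset]

theorem boundedAdd_le (M n m : ℕ) : boundedAdd M n m ≤ M + 1 := by
  unfold boundedAdd
  split <;> omega

theorem capEq_boundedAdd (M : ℕ) (v : Valuation C) (n : ℕ) :
    CapEq M (fun x => boundedAdd M (v x) n) (v.delay n) := fun x => by
  simp only [boundedAdd, Valuation.delay]
  split <;> omega

theorem Anchor.shift_le (M : ℕ) (a : Anchor C) (n : ℕ) (x : C) : (a.shift M n).1 x ≤ M + 1 := by
  have := boundedAdd_le M (a.1 x) n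
  simp only [Anchor.shift]
  omega

/-- On an uncapped clock the shift by `n` cancels. On a capped one both values exceed `M`, because
the delay `m` is at least `n`. -/
theorem Anchor.capEq_shift_delay {M n : ℕ} (a : Anchor C) (hn : n ≤ M + 1) {m : ℕ} (hm : n ≤ m) :
    CapEq M (Valuation.delay (a.shift M n).1 m) (Valuation.delay a.1 m) := fun x => by
  simp only [Anchor.shift, boundedAdd, Valuation.delay]
  split <;> omega

theorem Anchor.advanceReset_le (M : ℕ) (a : Anchor C) (n : ℕ) (R : Finset C) (hR : R ≠ ∅) (x : C) :
    (a.advanceReset M n R hR).1 x ≤ M + 1 := by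
  have := boundedAdd_le M (a.1 x) n
  simp only [Anchor.advanceReset, Valuation.reset]
  split <;> omega

theorem Anchor.capEq_advanceReset (M : ℕ) (a : Anchor C) (n : ℕ) (R : Finset C) (hR : R ≠ ∅) :
    CapEq M (Valuation.delay (a.advanceReset M n R hR).1 0)
      (Valuation.reset (Valuation.delay a.1 n) R) :=
  (capEq_boundedAdd M a.1 n).reset R

/-! ### Guards -/

section Guards

variable [Fintype C]

theorem lb_le_maxConst {A : TimedAutomaton L C} {e : Edge L C} (he : e ∈ A.edges) (x : C) :
    (e.guard x).lb ≤ maxConst A :=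
  (le_max_left _ _).trans <| (Finset.le_sup (f := fun x => max (e.guard x).lb
    (e.guard x).ub.toNat) (Finset.mem_univ x)).trans <|
    Finset.le_sup (f := fun e : Edge L C => Finset.univ.sup fun x => max (e.guard x).lb
      (e.guard x).ub.toNat) he

/-- Informative for finite upper bounds only, since `ENat.toNat ⊤ = 0`. -/
theorem toNat_ub_le_maxConst {A : TimedAutomaton L C} {e : Edge L C} (he : e ∈ A.edges) (x : C) :
    (e.guard x).ub.toNat ≤ maxConst A :=
  (le_max_right _ _).trans <| (Finset.le_sup (f := fun x => max (e.guard x).lb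
    (e.guard x).ub.toNat) (Finset.mem_univ x)).trans <|
    Finset.le_sup (f := fun e : Edge L C => Finset.univ.sup fun x => max (e.guard x).lb
      (e.guard x).ub.toNat) he

/-- A value above `M` meets every lower bound and violates every finite upper bound, so a guard
cannot distinguish two such values. -/
theorem CapEq.sat {A : TimedAutomaton L C} {e : Edge L C} (he : e ∈ A.edges) {u v : Valuation C}
    (h : CapEq (maxConst A) u v) (hu : Guard.Sat u e.guard) : Guard.Sat v e.guard := fun x => by
  have h1 := lb_le_maxConst he x
  have h2 := toNat_ub_le_maxConst he x
  obtain ⟨hl, hr⟩ := hu x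
  refine ⟨by have := h x; omega, ?_⟩
  cases hub : (e.guard x).ub with
  | top => exact le_top
  | coe b =>
    rw [hub] at h2 hr
    simp only [ENat.toNat_natCast, Nat.cast_le] at h2 hr ⊢
    have := h x
    omega

theorem coe_le_endDelay_iff (g : Guard C) (a : Anchor C) (n : ℕ) :
    ((n : ℤ) : WithTop ℤ) ≤ endDelay g a ↔ ∀ x, ((a.1 x + n : ℕ) : ℕ∞) ≤ (g x).ub := by
  simp only [endDelay, Finset.le_inf_iff, Finset.mem_univ, true_imp_iff]
  refine forall_congr' fun x => ?_
  cases (g x).ub with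
  | top => simp
  | coe b =>
    rw [ENat.map_natCast, WithTop.coe_le_coe, Nat.cast_le]
    omega

theorem sat_delay_iff (g : Guard C) (a : Anchor C) (n : ℕ) :
    Guard.Sat (Valuation.delay a.1 n) g ↔
      (Finset.univ.sup fun x => (g x).lb - a.1 x) ≤ n ∧ ((n : ℤ) : WithTop ℤ) ≤ endDelay g a := by
  rw [coe_le_endDelay_iff, Finset.sup_le_iff]
  simp only [Finset.mem_univ, true_imp_iff, Guard.Sat, Interval.Contains, Valuation.delay,
    ← forall_and]
  refine forall_congr' fun x => and_congr_left fun _ => ?_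
  omega

theorem startDelay_le {A : TimedAutomaton L C} {e : Edge L C} (he : e ∈ A.edges) (a : Anchor C)
    {w : ℕ} (hw : w ≤ maxConst A) : startDelay e.guard a w ≤ maxConst A :=
  max_le hw <| Finset.sup_le fun x _ => (Nat.sub_le _ _).trans (lb_le_maxConst he x)

/-- The hypothesis `s < p` forces `p ≥ 1`, so the truncated `p - 1` is exact and `n ≤ p - 1` means
`n < p`. -/
theorem mem_forValues {s b n : ℕ} {f : WithTop ℤ} {p : ℕ∞} (hp : (s : ℕ∞) < p) :
    n ∈ forValues s f p b ↔ s ≤ n ∧ ((n : ℤ) : WithTop ℤ) ≤ f ∧ (n : ℕ∞) < p ∧ n ≤ b := by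
  have hpn : ((n : ℤ) : WithTop ℤ) ≤ ENat.map (fun b : ℕ => (b : ℤ)) (p - 1) ↔ (n : ℕ∞) < p := by
    cases p with
    | top => simp
    | coe q =>
      have h1 : ((q : ℕ∞) - 1) = ((q - 1 : ℕ) : ℕ∞) := by simp
      rw [Nat.cast_lt] at hp ⊢
      rw [h1, ENat.map_natCast, WithTop.coe_le_coe]
      omega
  have hnb : ((n : ℤ) : WithTop ℤ) ≤ ((b : ℤ) : WithTop ℤ) ↔ n ≤ b := by
    rw [WithTop.coe_le_coe]
    omega
  simp only [forValues, List.mem_filter, List.mem_range, decide_eq_true_eq, le_min_iff]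
  rw [hpn]
  constructor
  · rintro ⟨h1, h2, h3, h4, -⟩
    exact ⟨h2, h3, h4, by omega⟩
  · rintro ⟨h1, h2, h3, h4⟩
    exact ⟨by omega, h1, h2, h3, hnb.2 h4⟩

theorem le_stopDelay (M : ℕ) (a : Anchor C) (R : Finset C) (s : ℕ) : s ≤ stopDelay M a R s :=
  le_max_left _ _

theorem lt_add_stopDelay (M : ℕ) (a : Anchor C) (R : Finset C) (s : ℕ) {x : C} (hx : x ∉ R) :
    M < a.1 x + stopDelay M a R s := by
  classical
  have h1 : ((M + 1 : ℕ) : ℕ∞) - (a.1 x : ℕ∞) ≤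
      ((M + 1 : ℕ) : ℕ∞) - (Finset.univ \ R).inf fun x => (a.1 x : ℕ∞) :=
    tsub_le_tsub_left (Finset.inf_le (f := fun x => (a.1 x : ℕ∞))
      (Finset.mem_sdiff.2 ⟨Finset.mem_univ x, hx⟩)) _
  have h2 := ENat.toNat_le_toNat h1
    (ne_top_of_le_ne_top (ENat.natCast_ne_top (M + 1)) tsub_le_self)
  rw [← ENat.natCast_sub, ENat.toNat_natCast] at h2
  have h3 : (((M + 1 : ℕ) : ℕ∞) - (Finset.univ \ R).inf fun x => (a.1 x : ℕ∞)).toNat ≤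
      stopDelay M a R s := by
    unfold stopDelay
    convert le_max_right _ _
  omega

/-- From `stop` on, every clock outside `R` exceeds `M`, so later delays give nothing new up to the
cap. This justifies cutting the for-loop at `stop`. -/
theorem capEq_reset_stopDelay (M : ℕ) (a : Anchor C) (R : Finset C) (s : ℕ) {n : ℕ}
    (hn : stopDelay M a R s ≤ n) :
    CapEq M (Valuation.reset (Valuation.delay a.1 (stopDelay M a R s)) R)
      (Valuation.reset (Valuation.delay a.1 n) R) := fun x => by
  by_cases hx : x ∈ R
  · simp [Valuation.reset, hx]
  · have := lt_add_stopDelay M a R s hx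
    simp only [Valuation.reset, hx, if_false, Valuation.delay]
    omega

end Guards

/-! ### Adding darts to the passed-waiting list -/

/-- The configuration `c` lies on a dart of `W`, up to the cap `M + 1`. -/
def Covers (M : ℕ) (W : PWList L C) (c : L × Valuation C) : Prop :=
  ∃ (a : Anchor C) (w : ℕ) (p : ℕ∞), W (c.1, a) = some (w, p) ∧
    ∃ d, w ≤ d ∧ CapEq M (Valuation.delay a.1 d) c.2

/-- `W'` arises from `W` by adding darts with passed distance `∞`. -/
structure Extends (W W' : PWList L C) : Prop where
  old : ∀ k w p, W k = some (w, p) → ∃ w' ≤ w, W' k = some (w', p)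
  new : ∀ k w p, W' k = some (w, p) → p = ⊤ ∨ ∃ w₀, W k = some (w₀, p)

theorem Extends.refl (W : PWList L C) : Extends W W :=
  ⟨fun _ w _ h => ⟨w, le_rfl, h⟩, fun _ w _ h => Or.inr ⟨w, h⟩⟩

theorem Extends.trans {W W' W'' : PWList L C} (h : Extends W W') (h' : Extends W' W'') :
    Extends W W'' := by
  refine ⟨fun k w p hk => ?_, fun k w p hk => ?_⟩
  · obtain ⟨w', hw', hk'⟩ := h.old k w p hk
    obtain ⟨w'', hw'', hk''⟩ := h'.old k w' p hk'
    exact ⟨w'', hw''.trans hw', hk''⟩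
  · obtain hp | ⟨w', hk'⟩ := h'.new k w p hk
    · exact Or.inl hp
    · exact h.new k w' p hk'

theorem Covers.extend {M : ℕ} {W W' : PWList L C} {c : L × Valuation C} (hc : Covers M W c)
    (h : Extends W W') : Covers M W' c := by
  obtain ⟨a, w, p, hk, d, hd, hcap⟩ := hc
  obtain ⟨w', hw', hk'⟩ := h.old _ _ _ hk
  exact ⟨a, w', p, hk', d, hw'.trans hd, hcap⟩

theorem addToPW_eq_none_iff {lg : L} {W : PWList L C} {l : L} {a : Anchor C} {w : ℕ} {p : ℕ∞} :
    addToPW lg W l a w p = none ↔ l = lg := by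
  unfold addToPW
  split
  · simpa
  · split <;> simpa

/-- Taking the minimum with `⊤` leaves the passed distance of an existing entry alone. The minimum
of two waiting distances is one of them, so soundness of the new entry comes from the old entry or
from the added dart. -/
theorem extends_of_addToPW {lg : L} {W W' : PWList L C} {l : L} {a : Anchor C} {w : ℕ}
    (h : addToPW lg W l a w ⊤ = some W') :
    Extends W W' ∧ (∃ w' ≤ w, ∃ p, W' (l, a) = some (w', p)) ∧
      ∀ k w' p, W' k = some (w', p) → (∃ p₀, W k = some (w', p₀)) ∨ (k = (l, a) ∧ w' = w) := by
  classical
  unfold addToPW at h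
  split at h
  · cases h
  · split at h
    · rename_i hnone
      obtain rfl := (Option.some.inj h).symm
      refine ⟨⟨fun k w' p hk => ?_, fun k w' p hk => ?_⟩, ⟨w, le_rfl, ⊤, by simp⟩,
        fun k w' p hk => ?_⟩
      · have : k ≠ (l, a) := by
          rintro rfl
          rw [hnone] at hk
          cases hk
        exact ⟨w', le_rfl, by simpa [Function.update_of_ne this] using hk⟩
      · by_cases hkk : k = (l, a)
        · subst hkk
          simp at hk
          exact Or.inl hk.2.symm
        · exact Or.inr ⟨w', by simpa [Function.update_of_ne hkk] using hk⟩
      · by_cases hkk : k = (l, a)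
        · subst hkk
          simp at hk
          exact Or.inr ⟨rfl, hk.1.symm⟩
        · exact Or.inl ⟨p, by simpa [Function.update_of_ne hkk] using hk⟩
    · rename_i w₀ p₀ hsome
      obtain rfl := (Option.some.inj h).symm
      refine ⟨⟨fun k w' p hk => ?_, fun k w' p hk => ?_⟩, ⟨min w w₀, min_le_left _ _, p₀, by simp⟩,
        fun k w' p hk => ?_⟩
      · by_cases hkk : k = (l, a)
        · subst hkk
          rw [hsome] at hk
          simp only [Option.some.injEq, Prod.mk.injEq] at hk
          exact ⟨min w w₀, hk.1 ▸ min_le_right _ _, by simp [hk.2]⟩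
        · exact ⟨w', le_rfl, by simpa [Function.update_of_ne hkk] using hk⟩
      · by_cases hkk : k = (l, a)
        · subst hkk
          simp at hk
          exact Or.inr ⟨w₀, by rw [hsome, hk.2]⟩
        · exact Or.inr ⟨w', by simpa [Function.update_of_ne hkk] using hk⟩
      · by_cases hkk : k = (l, a)
        · subst hkk
          simp at hk
          rcases le_total w w₀ with hle | hle
          · exact Or.inr ⟨rfl, by rw [← hk.1, min_eq_left hle]⟩
          · exact Or.inl ⟨p₀, by rw [hsome, ← hk.1, min_eq_right hle]⟩
        · exact Or.inl ⟨p, by simpa [Function.update_of_ne hkk] using hk⟩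

/-- Nonemptiness matters for returning true: it supplies a sound dart at the goal, which witnesses
reachability. -/
theorem eq_goal_of_foldlM_addToPW_eq_none {lg l : L} (ds : List (Anchor C × ℕ)) {W : PWList L C}
    (h : ds.foldlM (fun W' d => addToPW lg W' l d.1 d.2 ⊤) W = none) : l = lg ∧ ds ≠ [] := by
  induction ds generalizing W with
  | nil => cases h
  | cons d ds ih =>
    rw [List.foldlM_cons] at h
    refine ⟨?_, by simp⟩
    by_contra hl
    obtain ⟨W₁, h₁⟩ := Option.ne_none_iff_exists'.1
      (mt (addToPW_eq_none_iff (W := W) (a := d.1) (w := d.2) (p := ⊤)).1 hl)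
    rw [h₁] at h
    exact hl (ih h).1

theorem update_passed_cases {W : PWList L C} {k₀ : L × Anchor C} {w : ℕ} {p : ℕ∞}
    [DecidableEq (L × Anchor C)]
    (hk₀ : W k₀ = some (w, p)) {k : L × Anchor C} {w' : ℕ} {p' : ℕ∞}
    (hk : Function.update W k₀ (some (w, (w : ℕ∞))) k = some (w', p')) :
    W k = some (w', p') ∨ (k = k₀ ∧ w' = w ∧ p' = w) := by
  by_cases hkk : k = k₀
  · subst hkk
    rw [Function.update_self] at hk
    cases hk
    exact Or.inr ⟨rfl, rfl, rfl⟩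
  · rw [Function.update_of_ne hkk] at hk
    exact Or.inl hk

theorem Covers.update_passed {M : ℕ} {W : PWList L C} {k₀ : L × Anchor C} {w : ℕ} {p : ℕ∞}
    [DecidableEq (L × Anchor C)] (hk₀ : W k₀ = some (w, p)) {c : L × Valuation C}
    (hc : Covers M W c) : Covers M (Function.update W k₀ (some (w, (w : ℕ∞)))) c := by
  obtain ⟨a, w', p', hk, hd⟩ := hc
  by_cases hkk : (c.1, a) = k₀
  · rw [hkk, hk₀] at hk
    cases hk
    exact ⟨a, w, w, by rw [hkk, Function.update_self], hd⟩
  · exact ⟨a, w', p', by rwa [Function.update_of_ne hkk], hd⟩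

/-! ### Ranks of entries -/

/-- A natural number that decreases when an entry of the passed-waiting list is created or when
its passed distance is decreased to at most `M`. -/
noncomputable def entryRank (M : ℕ) : Option (ℕ × ℕ∞) → ℕ
  | none => M + 2
  | some (_, p) => (min p ((M + 1 : ℕ) : ℕ∞)).toNat

theorem entryRank_some_le (M : ℕ) (w : ℕ) (p : ℕ∞) : entryRank M (some (w, p)) ≤ M + 1 :=
  ENat.toNat_le_of_le_natCast (min_le_right _ _)

/-- As `w ≤ M`, the new passed distance lies strictly below the truncation `M + 1`, hence below `min
p (M + 1)`, even for `p = ⊤`. -/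
theorem entryRank_passed_lt {M w : ℕ} {p : ℕ∞} (hw : w ≤ M) (hp : (w : ℕ∞) < p) :
    entryRank M (some (w, (w : ℕ∞))) < entryRank M (some (w, p)) := by
  have h1 : entryRank M (some (w, (w : ℕ∞))) = w := by
    have : (w : ℕ∞) ≤ ((M + 1 : ℕ) : ℕ∞) := by exact_mod_cast hw.trans (Nat.le_succ M)
    simp only [entryRank]
    rw [min_eq_left this, ENat.toNat_natCast]
  rw [h1]
  cases p with
  | top =>
    simp only [entryRank]
    rw [min_eq_right le_top, ENat.toNat_natCast]
    omega
  | coe q =>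
    simp only [entryRank]
    rw [show min (q : ℕ∞) ((M + 1 : ℕ) : ℕ∞) = ((min q (M + 1) : ℕ) : ℕ∞) from
      (Nat.mono_cast.map_min).symm, ENat.toNat_natCast]
    rw [Nat.cast_lt] at hp
    omega

theorem Extends.entryRank_le {W W' : PWList L C} (h : Extends W W') (M : ℕ) (k : L × Anchor C) :
    entryRank M (W' k) ≤ entryRank M (W k) := by
  cases hk : W k with
  | none =>
    cases hk' : W' k with
    | none => exact le_rfl
    | some q => exact (entryRank_some_le M q.1 q.2).trans (Nat.le_succ _)
  | some q =>
    obtain ⟨w', -, hk'⟩ := h.old k q.1 q.2 hk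
    rw [hk']
    exact le_rfl

/-! ### Soundness of darts -/

/-- The configurations of the dart `(l, a)` from `w` on are reachable up to the cap, and the
dart belongs to a finite set determined by the automaton. -/
structure SoundDart [Fintype C] (A : TimedAutomaton L C) (l : L) (a : Anchor C) (w : ℕ) :
    Prop where
  anchor_le : ∀ x, a.1 x ≤ maxConst A + 1
  wait_le : w ≤ maxConst A
  reach : ∃ v, (discreteSemantics A).Reaches (A.init, fun _ => 0) (l, v) ∧
    CapEq (maxConst A) v (Valuation.delay a.1 w)

/-- All darts of `W` are sound, none has location `lg`, and the initial configuration is covered. -/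
structure SoundList [Fintype C] (A : TimedAutomaton L C) (lg : L) (W : PWList L C) : Prop where
  sound : ∀ l a w p, W (l, a) = some (w, p) → SoundDart A l a w
  ne_goal : ∀ l a w p, W (l, a) = some (w, p) → l ≠ lg
  init : Covers (maxConst A) W (A.init, fun _ => 0)

section Algorithm

variable [Fintype C] {A : TimedAutomaton L C} {lg : L}

theorem SoundDart.locReachable {a : Anchor C} {w : ℕ} (h : SoundDart A lg a w) :
    LocReachable A lg :=
  let ⟨v, hv, _⟩ := h.reach
  ⟨v, hv⟩

theorem SoundList.addToPW {W W' : PWList L C} (hW : SoundList A lg W) {l : L} {a : Anchor C}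
    {w : ℕ} (hd : SoundDart A l a w) (h : addToPW lg W l a w ⊤ = some W') :
    SoundList A lg W' := by
  obtain ⟨hext, -, hnew⟩ := extends_of_addToPW h
  have hl : l ≠ lg := fun hl => by
    rw [addToPW_eq_none_iff.2 hl] at h
    cases h
  refine ⟨fun l' a' w' p' hk => ?_, fun l' a' w' p' hk => ?_, hW.init.extend hext⟩
  all_goals
    obtain ⟨p₀, hk'⟩ | ⟨hka, rfl⟩ := hnew _ _ _ hk
  · exact hW.sound _ _ _ _ hk'
  · cases hka
    exact hd
  · exact hW.ne_goal _ _ _ _ hk'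
  · cases hka
    exact hl

theorem foldlM_addToPW_eq_some {l : L} (ds : List (Anchor C × ℕ)) {W W' : PWList L C}
    (hds : ∀ d ∈ ds, SoundDart A l d.1 d.2) (hW : SoundList A lg W)
    (h : ds.foldlM (fun W' d => addToPW lg W' l d.1 d.2 ⊤) W = some W') :
    Extends W W' ∧ SoundList A lg W' ∧
      ∀ d ∈ ds, ∃ w' ≤ d.2, ∃ p, W' (l, d.1) = some (w', p) := by
  induction ds generalizing W with
  | nil =>
    obtain rfl : W = W' := by simpa using h
    exact ⟨Extends.refl W, hW, by simp⟩
  | cons d ds ih =>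
    rw [List.foldlM_cons] at h
    obtain ⟨W₁, h₁, h⟩ := Option.bind_eq_some_iff.1 h
    obtain ⟨hext, ⟨w', hw', p, hk⟩, -⟩ := extends_of_addToPW h₁
    obtain ⟨hext', hs, hcov⟩ := ih (fun d hd => hds d (List.mem_cons_of_mem _ hd))
      (hW.addToPW (hds d List.mem_cons_self) h₁) h
    refine ⟨hext.trans hext', hs, fun d' hd' => ?_⟩
    obtain rfl | hd' := List.mem_cons.1 hd'
    · obtain ⟨w'', hw'', hk'⟩ := hext'.old _ _ _ hk
      exact ⟨w'', hw''.trans hw', p, hk'⟩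
    · exact hcov d' hd'

/-- The reachable configuration matching `α + w` is delayed by `n - w`; it then matches `α + n` up
to the cap and passes the same guard. -/
theorem SoundDart.delay_switch {a : Anchor C} {w : ℕ} {e : Edge L C} (he : e ∈ A.edges)
    (h : SoundDart A e.src a w) {n : ℕ} (hn : w ≤ n)
    (hsat : Guard.Sat (Valuation.delay a.1 n) e.guard) :
    ∃ v, (discreteSemantics A).Reaches (A.init, fun _ => 0) (e.tgt, v) ∧
      CapEq (maxConst A) v (Valuation.reset (Valuation.delay a.1 n) e.resets) := by
  obtain ⟨v, hv, hcap⟩ := h.reach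
  have hcap' : CapEq (maxConst A) (v.delay (n - w)) (Valuation.delay a.1 n) := by
    have := hcap.delay (n - w)
    rwa [Valuation.delay_delay, Nat.add_sub_cancel' hn] at this
  exact ⟨_, (hv.tail ⟨_, .delay _ _ (n - w)⟩).tail ⟨_, .switch e he _ (hcap'.symm.sat he hsat)⟩,
    hcap'.reset _⟩

/-- Processing an edge adds a list of sound darts that cover all switches along the edge from the
configurations of the selected dart. -/
theorem exists_processEdge_eq_foldlM {a : Anchor C} {w : ℕ} {p : ℕ∞} {e : Edge L C}
    (he : e ∈ A.edges) (hd : SoundDart A e.src a w) :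
    ∃ ds : List (Anchor C × ℕ),
      (∀ W, processEdge A lg a w p e W =
        ds.foldlM (fun W' d => addToPW lg W' e.tgt d.1 d.2 ⊤) W) ∧
      (∀ d ∈ ds, SoundDart A e.tgt d.1 d.2) ∧
      ∀ n : ℕ, w ≤ n → (n : ℕ∞) < p → Guard.Sat (Valuation.delay a.1 n) e.guard →
        ∃ d ∈ ds, ∃ m, d.2 ≤ m ∧ CapEq (maxConst A) (Valuation.delay d.1.1 m)
          (Valuation.reset (Valuation.delay a.1 n) e.resets) := by
  set M := maxConst A with hM
  set s := startDelay e.guard a w with hs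
  have hsM : s ≤ M := startDelay_le he a hd.wait_le
  have hws : w ≤ s := le_max_left _ _
  have hgs : (Finset.univ.sup fun x => (e.guard x).lb - a.1 x) ≤ s := le_max_right _ _
  have hsn : ∀ n, w ≤ n → Guard.Sat (Valuation.delay a.1 n) e.guard → s ≤ n :=
    fun n hn hsat => max_le hn ((sat_delay_iff _ _ _).1 hsat).1
  by_cases hcond : (s : ℕ∞) < p ∧ ((s : ℤ) : WithTop ℤ) ≤ endDelay e.guard a
  · by_cases hR : e.resets = ∅
    · refine ⟨[(a.shift M s, s)], fun W => ?_, ?_, fun n hn _ hsat => ?_⟩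
      · simp only [processEdge, ← hM, ← hs, if_pos hcond, dif_pos hR, List.foldlM_cons,
          List.foldlM_nil]
        exact (bind_pure _).symm
      · simp only [List.mem_singleton, forall_eq]
        obtain ⟨v, hv, hcap⟩ := hd.delay_switch he hws ((sat_delay_iff _ _ _).2 ⟨hgs, hcond.2⟩)
        rw [hR, Valuation.reset_empty] at hcap
        exact ⟨a.shift_le M s, hsM, v, hv,
          hcap.trans (a.capEq_shift_delay (by omega) le_rfl).symm⟩
      · have hsn' := hsn n hn hsat
        rw [hR, Valuation.reset_empty]
        exact ⟨_, List.mem_singleton_self _, n, hsn', a.capEq_shift_delay (by omega) hsn'⟩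
    · refine ⟨(forValues s (endDelay e.guard a) p (stopDelay M a e.resets s)).map
        fun n => (a.advanceReset M n e.resets hR, 0), fun W => ?_, fun d hd' => ?_,
        fun n hn hp hsat => ?_⟩
      · simp only [processEdge, ← hM, ← hs, if_pos hcond, dif_neg hR, List.foldlM_map]
      · obtain ⟨n, hn, rfl⟩ := List.mem_map.1 hd'
        obtain ⟨h1, h2, h3, h4⟩ := (mem_forValues hcond.1).1 hn
        obtain ⟨v, hv, hcap⟩ := hd.delay_switch he (hws.trans h1)
          ((sat_delay_iff _ _ _).2 ⟨hgs.trans h1, h2⟩)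
        exact ⟨a.advanceReset_le M n e.resets hR, Nat.zero_le _, v, hv,
          hcap.trans (a.capEq_advanceReset M n e.resets hR).symm⟩
      · have hend := ((sat_delay_iff _ _ _).1 hsat).2
        rcases le_total n (stopDelay M a e.resets s) with hns | hns
        · exact ⟨_, List.mem_map_of_mem ((mem_forValues hcond.1).2 ⟨hsn n hn hsat, hend, hp, hns⟩),
            0, le_rfl, a.capEq_advanceReset M n e.resets hR⟩
        -- Beyond `stop`, the dart added for `stop` serves for `n` as well. The bounds by `end` and
        -- `p` pass from `n` down to `stop ≤ n`.
        · refine ⟨_, List.mem_map_of_mem ((mem_forValues hcond.1).2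
            ⟨le_stopDelay M a e.resets s, le_trans ?_ hend, lt_of_le_of_lt ?_ hp, le_rfl⟩),
            0, le_rfl, (a.capEq_advanceReset M _ e.resets hR).trans
              (capEq_reset_stopDelay M a e.resets s hns)⟩
          · rw [WithTop.coe_le_coe]
            exact_mod_cast hns
          · exact_mod_cast hns
  -- An enabled delay `n` in `[w, p)` would satisfy `start ≤ n`, hence `start < p` and `start ≤
  -- end`: a skipped edge has no switches to cover.
  · refine ⟨[], fun W => ?_, by simp, fun n hn hp hsat => (hcond ?_).elim⟩
    · simp only [processEdge, ← hs, if_neg hcond]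
      rfl
    · have hsn' := hsn n hn hsat
      refine ⟨lt_of_le_of_lt ?_ hp, le_trans ?_ ((sat_delay_iff _ _ _).1 hsat).2⟩
      · exact_mod_cast hsn'
      · rw [WithTop.coe_le_coe]
        exact_mod_cast hsn'

/-! ### The invariant of the algorithm -/

/-- All switches from passed configurations of `W` lead to covered configurations, except possibly
for those in `pending`. -/
def ClosedUpTo (A : TimedAutomaton L C) (W : PWList L C)
    (pending : Edge L C → Anchor C → ℕ → Prop) : Prop :=
  ∀ e ∈ A.edges, ∀ (a : Anchor C) (w : ℕ) (p : ℕ∞), W (e.src, a) = some (w, p) →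
    ∀ d : ℕ, p ≤ d → Guard.Sat (Valuation.delay a.1 d) e.guard →
      Covers (maxConst A) W (e.tgt, Valuation.reset (Valuation.delay a.1 d) e.resets) ∨
        pending e a d

/-- The invariant of the algorithm. -/
def AlgInv (A : TimedAutomaton L C) (lg : L) : AlgState L C → Prop
  | .whileLoop W => SoundList A lg W ∧ ClosedUpTo A W fun _ _ _ => False
  | .forEach W a w p todo => SoundList A lg W ∧ todo ⊆ A.edges ∧
      (∀ e ∈ todo, SoundDart A e.src a w) ∧
      ClosedUpTo A W fun e a' d => a' = a ∧ e ∈ todo ∧ w ≤ d ∧ (d : ℕ∞) < p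
  | .returned b => b = true ↔ LocReachable A lg

theorem algInv_initState (A : TimedAutomaton L C) (lg : L) : AlgInv A lg (initState A lg) := by
  unfold initState
  split
  · rename_i h
    exact iff_of_true rfl ⟨fun _ => 0, addToPW_eq_none_iff.1 h ▸ .refl⟩
  · rename_i W h
    have hl : A.init ≠ lg := fun hl => by
      rw [addToPW_eq_none_iff.2 hl] at h
      cases h
    obtain ⟨hext, ⟨w', hw', p, hk⟩, hnew⟩ := extends_of_addToPW h
    refine ⟨⟨fun l a w p hk => ?_, fun l a w p hk => ?_, _, _, _, hk, 0, hw', CapEq.refl _ _⟩,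
      fun e _ a w p hk d hd _ => ?_⟩
    · obtain ⟨_, hk'⟩ | ⟨hka, rfl⟩ := hnew _ _ _ hk
      · cases hk'
      · cases hka
        exact ⟨fun x => Nat.zero_le _, Nat.zero_le _, _, .refl, CapEq.refl _ _⟩
    · obtain ⟨_, hk'⟩ | ⟨hka, rfl⟩ := hnew _ _ _ hk
      · cases hk'
      · cases hka
        exact hl
    -- The only entry has passed distance `⊤`, so no point is passed yet.
    · obtain rfl | ⟨_, hk'⟩ := hext.new _ _ _ hk
      · exact absurd hd (by simp)
      · cases hk'

/-- Induction along the run. A delay stays on the same dart; before a switch, the exit condition `p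
≤ w` makes the representing point passed, so `ClosedUpTo` applies. -/
theorem covers_of_reaches {W : PWList L C} (hW : SoundList A lg W)
    (hcl : ClosedUpTo A W fun _ _ _ => False)
    (hexit : ¬ ∃ (l : L) (a : Anchor C) (w : ℕ) (p : ℕ∞), W (l, a) = some (w, p) ∧ (w : ℕ∞) < p)
    {c : L × Valuation C} (hc : (discreteSemantics A).Reaches (A.init, fun _ => 0) c) :
    Covers (maxConst A) W c := by
  refine Relation.ReflTransGen.rec hW.init (fun {c c'} _ hstep ih => ?_) hc
  obtain ⟨act, hstep⟩ := hstep
  obtain ⟨a, w, p, hk, d, hwd, hcap⟩ := ih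
  cases hstep with
  | delay l v d' =>
    refine ⟨a, w, p, hk, d + d', by omega, ?_⟩
    rw [← Valuation.delay_delay]
    exact hcap.delay d'
  | switch e he v hv =>
    have hpd : p ≤ (d : ℕ∞) :=
      (not_lt.1 fun hlt => hexit ⟨_, a, w, p, hk, hlt⟩).trans (by exact_mod_cast hwd)
    obtain ⟨a', w', p', hk', d', hwd', hcap'⟩ :=
      (hcl e he a w p hk d hpd (hcap.symm.sat he hv)).resolve_right id
    exact ⟨a', w', p', hk', d', hwd', hcap'.trans (hcap.reset _)⟩

theorem AlgInv.step {s s' : AlgState L C} (hs : AlgInv A lg s) (h : AlgStep A lg s s') :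
    AlgInv A lg s' := by
  classical
  cases h with
  | select W l a w p hk hwp =>
    obtain ⟨hW, hcl⟩ := hs
    refine ⟨⟨fun l' a' w' p' hk' => ?_, fun l' a' w' p' hk' => ?_, hW.init.update_passed hk⟩,
      Finset.filter_subset _ _, fun e he => ?_, fun e he a' w' p' hk' d hd hsat => ?_⟩
    · obtain hk' | ⟨hkk, rfl, -⟩ := update_passed_cases hk hk'
      · exact hW.sound _ _ _ _ hk'
      · exact hW.sound _ _ _ _ (hkk ▸ hk)
    · obtain hk' | ⟨hkk, rfl, -⟩ := update_passed_cases hk hk'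
      · exact hW.ne_goal _ _ _ _ hk'
      · exact hW.ne_goal _ _ _ _ (hkk ▸ hk)
    · rw [(Finset.mem_filter.1 he).2]
      exact hW.sound _ _ _ _ hk
    · obtain hk' | ⟨hkk, rfl, rfl⟩ := update_passed_cases hk hk'
      · exact Or.inl (((hcl e he a' w' p' hk' d hd hsat).resolve_right id).update_passed hk)
      · obtain ⟨rfl, rfl⟩ := Prod.mk.inj hkk
        -- Lowering the passed distance from `p` to `w` makes exactly the delays in `[w, p)` newly
        -- passed. They become pending; larger ones were already closed.
        by_cases hdp : (d : ℕ∞) < p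
        · exact Or.inr ⟨rfl, Finset.mem_filter.2 ⟨he, rfl⟩, by exact_mod_cast hd, hdp⟩
        · exact Or.inl (((hcl e he _ _ p hk d (not_lt.1 hdp) hsat).resolve_right
            id).update_passed hk)
  | exit W hexit =>
    obtain ⟨hW, hcl⟩ := hs
    refine iff_of_false Bool.false_ne_true ?_
    rintro ⟨v, hv⟩
    obtain ⟨a, w, p, hk, -⟩ := covers_of_reaches hW hcl hexit hv
    exact hW.ne_goal _ _ _ _ hk rfl
  | edge W W' a w p todo e he h =>
    obtain ⟨hW, hsub, hd, hcl⟩ := hs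
    obtain ⟨ds, heq, hsound, hcov⟩ := exists_processEdge_eq_foldlM (lg := lg) (p := p) (hsub he)
      (hd e he)
    rw [heq] at h
    obtain ⟨hext, hW', hmem⟩ := foldlM_addToPW_eq_some ds hsound hW h
    refine ⟨hW', (Finset.erase_subset _ _).trans hsub,
      fun e' he' => hd e' (Finset.mem_of_mem_erase he'), fun e' he' a' w' p' hk' d hpd hsat => ?_⟩
    -- Added darts pass nothing new: a passed distance in `W'` is either `⊤` or the one already in
    -- `W`.
    obtain rfl | ⟨w₀, hk₀⟩ := hext.new _ _ _ hk'
    · exact absurd hpd (by simp)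
    obtain hc | ⟨rfl, het, hwd, hdp⟩ := hcl e' he' a' w₀ p' hk₀ d hpd hsat
    · exact Or.inl (hc.extend hext)
    · by_cases hee : e' = e
      · subst hee
        obtain ⟨d', hd', m, hm, hcap⟩ := hcov d hwd hdp hsat
        obtain ⟨w'', hw'', p'', hk''⟩ := hmem d' hd'
        exact Or.inl ⟨_, _, _, hk'', m, hw''.trans hm, hcap⟩
      · exact Or.inr ⟨rfl, Finset.mem_erase.2 ⟨hee, het⟩, hwd, hdp⟩
  | edgeReturn W a w p todo e he h =>
    obtain ⟨hW, hsub, hd, hcl⟩ := hs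
    obtain ⟨ds, heq, hsound, hcov⟩ := exists_processEdge_eq_foldlM (lg := lg) (p := p) (hsub he)
      (hd e he)
    rw [heq] at h
    obtain ⟨htgt, hne⟩ := eq_goal_of_foldlM_addToPW_eq_none ds h
    obtain ⟨d, hd'⟩ := List.exists_mem_of_ne_nil _ hne
    exact iff_of_true rfl (htgt ▸ hsound d hd').locReachable
  | endForEach W a w p =>
    obtain ⟨hW, -, -, hcl⟩ := hs
    refine ⟨hW, fun e he a' w' p' hk d hd hsat => ?_⟩
    exact Or.inl ((hcl e he a' w' p' hk d hd hsat).resolve_right fun h => by simp at h)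

theorem AlgReaches.inv {s : AlgState L C} (h : AlgReaches A lg s) : AlgInv A lg s :=
  Relation.ReflTransGen.rec (algInv_initState A lg) (fun _ hstep ih => ih.step hstep) h

/-! ### Termination -/

theorem finite_bounded_keys [Finite L] (B : ℕ) :
    {k : L × Anchor C | ∀ x, k.2.1 x ≤ B}.Finite := by
  have h : (Set.univ ×ˢ {v : Valuation C | ∀ x, v x ≤ B} : Set (L × Valuation C)).Finite :=
    Set.finite_univ.prod (Set.Finite.pi' fun _ => Set.finite_Iic B)
  refine (h.preimage (f := fun k : L × Anchor C => (k.1, k.2.1)) ?_).subset fun k hk =>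
    ⟨Set.mem_univ _, hk⟩
  rintro ⟨l, a⟩ - ⟨l', a'⟩ - heq
  obtain ⟨hl, ha⟩ := Prod.mk.inj heq
  exact Prod.ext hl (Subtype.ext ha)

/-- The total rank of the entries of a passed-waiting list. -/
noncomputable def listRank [Finite L] (A : TimedAutomaton L C) (W : PWList L C) : ℕ :=
  ∑ k ∈ (finite_bounded_keys (L := L) (C := C) (maxConst A + 1)).toFinset,
    entryRank (maxConst A) (W k)

theorem Extends.listRank_le [Finite L] {W W' : PWList L C} (h : Extends W W') :
    listRank A W' ≤ listRank A W :=
  Finset.sum_le_sum fun k _ => h.entryRank_le _ k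

/-- The rank of a state of the algorithm, which decreases in every step. -/
noncomputable def stateRank [Finite L] (A : TimedAutomaton L C) : AlgState L C → ℕ ×ₗ ℕ
  | .whileLoop W => toLex (listRank A W, 1)
  | .forEach W _ _ _ todo => toLex (listRank A W, todo.card + 2)
  | .returned _ => toLex (0, 0)

/-- Selection lowers the list rank; the other steps to a non-final state do not raise it and lower
the second component. The offsets order a finished foreach-loop (2), the while-loop (1) and a
returned state (0). -/
theorem AlgInv.stateRank_lt [Finite L] {s s' : AlgState L C} (hs : AlgInv A lg s)
    (h : AlgStep A lg s s') : stateRank A s' < stateRank A s := by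
  classical
  cases h with
  | select W l a w p hk hwp =>
    have hd := hs.1.sound _ _ _ _ hk
    refine Prod.Lex.toLex_lt_toLex.2 (Or.inl ?_)
    -- The sum runs over bounded keys only; soundness of the selected dart puts its key among them.
    refine Finset.sum_lt_sum (fun k _ => ?_)
      ⟨(l, a), (Set.Finite.mem_toFinset _).2 hd.anchor_le, ?_⟩
    · by_cases hkk : k = (l, a)
      · subst hkk
        rw [Function.update_self, hk]
        exact (entryRank_passed_lt hd.wait_le hwp).le
      · rw [Function.update_of_ne hkk]
    · rw [Function.update_self, hk]
      exact entryRank_passed_lt hd.wait_le hwp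
  | exit W hexit =>
    exact Prod.Lex.toLex_lt_toLex.2 <| (listRank A W).eq_zero_or_pos.symm.imp_right
      fun h0 => ⟨h0.symm, Nat.succ_pos _⟩
  | edge W W' a w p todo e he h =>
    obtain ⟨hW, hsub, hd, hcl⟩ := hs
    obtain ⟨ds, heq, hsound, -⟩ := exists_processEdge_eq_foldlM (lg := lg) (p := p) (hsub he)
      (hd e he)
    rw [heq] at h
    have hle := (foldlM_addToPW_eq_some ds hsound hW h).1.listRank_le (A := A)
    refine Prod.Lex.toLex_lt_toLex.2 (hle.lt_or_eq.imp_right fun heq' =>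
      ⟨heq', Nat.add_lt_add_right ?_ 2⟩)
    convert Finset.card_erase_lt_of_mem he
  | edgeReturn W a w p todo e he h =>
    exact Prod.Lex.toLex_lt_toLex.2 <| (listRank A W).eq_zero_or_pos.symm.imp_right
      fun h0 => ⟨h0.symm, Nat.succ_pos _⟩
  | endForEach W a w p =>
    exact Prod.Lex.toLex_lt_toLex.2 (Or.inr ⟨rfl, Nat.lt_succ_self _⟩)

theorem exists_algStep_or_returned (A : TimedAutomaton L C) (lg : L) (s : AlgState L C) :
    (∃ s', AlgStep A lg s s') ∨ ∃ b, s = .returned b := by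
  cases s with
  | whileLoop W =>
    left
    by_cases h : ∃ (l : L) (a : Anchor C) (w : ℕ) (p : ℕ∞), W (l, a) = some (w, p) ∧ (w : ℕ∞) < p
    · obtain ⟨l, a, w, p, hk, hwp⟩ := h
      exact ⟨_, .select W l a w p hk hwp⟩
    · exact ⟨_, .exit W h⟩
  | forEach W a w p todo =>
    left
    obtain rfl | ⟨e, he⟩ := todo.eq_empty_or_nonempty
    · exact ⟨_, .endForEach W a w p⟩
    · cases h : processEdge A lg a w p e W with
      | none => exact ⟨_, .edgeReturn W a w p todo e he h⟩
      | some W' => exact ⟨_, .edge W W' a w p todo e he h⟩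
  | returned b => exact Or.inr ⟨b, rfl⟩

theorem algTerminates [Finite L] (A : TimedAutomaton L C) (lg : L) : AlgTerminates A lg := by
  refine ⟨?_, fun s _ hstuck => (exists_algStep_or_returned A lg s).resolve_left
    fun ⟨s', hs'⟩ => hstuck s' hs'⟩
  rintro ⟨r, h0, hr⟩
  have hinv : ∀ i, AlgInv A lg (r i) := fun i => by
    induction i with
    | zero => exact h0 ▸ algInv_initState A lg
    | succ i ih => exact ih.step (hr i)
  exact (RelEmbedding.natGT (r := (· < ·)) (fun i => stateRank A (r i))
    fun i => (hinv i).stateRank_lt (hr i)).not_wellFounded wellFounded_lt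

end Algorithm

end TimedDarts

theorem mainTheorem1 {L C : Type*} [Finite L] [Fintype C]
    (A : TimedDarts.TimedAutomaton L C) (lg : L) :
    TimedDarts.AlgTerminates A lg ∧
      ∀ b : Bool, TimedDarts.AlgReaches A lg (TimedDarts.AlgState.returned b) →
        (b = true ↔ TimedDarts.LocReachable A lg) :=
  ⟨TimedDarts.algTerminates A lg, fun _ h => h.inv⟩
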